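/- Consider a finite two-player zero-sum extensive-form game (with chance moves) with perfect recall. For each player $i$ let $\mathcal J_i$ be his set of information sets (decision points), $A_j$ the actions at $j\in\mathcal J_i$, $n_j=|A_j|$, and identify the observation node reached after action $a$ at $j$ with the pair $(j,a)$; its children are the information sets of player $i$ whose own history is the own history of $j$ followed by $(j,a)$, and $n_{(j,a)}$ is their number. The root of the player's sequential decision process is an observation node $r$ whose $n_r$ children are his first information sets. The sequence form of a behavioral strategy gives each pair $(j,a)$ the product of the probabilities of the player's own actions up to and including $a$ at $j$; for the subprocess rooted at $j$ the product starts at $j$. Let $B_j$ be any upper bound on the Euclidean norm of the sequence-form strategies of the subprocess rooted at $j$. For a parameter $\kappa>0$ put $\gamma_r=\kappa$, $\gamma_v=\gamma_u/(2\sqrt{n_u})$ if the parent $u$ of $v$ is a decision point, $\gamma_v=\gamma_u/\sqrt{n_u}$ if $u$ is an observation node, and $\kappa_j=\gamma_j/(2\sqrt{n_j}\,B_j)$. A predictive regret minimizer on a convex compact set $X$ outputs $x^t\in X$ as a function of the losses $\ell^1,\dots,\ell^{t-1}$ and the predictions $m^1,\dots,m^t$. It is $(\kappa,\alpha,\beta)$-stable-predictive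 on the losses and predictions that it receives if $\|x^{t+1}-x^t\|_2\le\kappa$ for all $t\ge1$ and, for all $T$, $$\sum_{t=1}^T\langle\ell^t,x^t\rangle-\min_{z\in X}\sum_{t=1}^T\langle\ell^t,z\rangle\le\frac{\alpha}{\kappa}+\beta\kappa\sum_{t=1}^T\|\ell^t-m^t\|_2^2 .$$ Let the two players play against each other as follows. There is one local predictive regret minimizer on the simplex $\Delta^{n_j}$ for every decision point $j$ of each player, and at round $t$ each player's behavioral strategy is formed by the outputs of his local minimizers; let $x^t,y^t$ be the sequence forms. With $M$ the matrix of leaf payoffs to player 1, weighted by the chance probabilities and indexed by the players' sequences including the empty one (which has weight 1), the loss vectors are $\ell_1^t=-My^t$ and $\ell_2^t=M^\top x^t$ (without the empty-sequence entry), and the predictions are $m_i^t=\ell_i^{t-1}$ for $t\ge2$, with $m_i^1$ arbitrary. The local minimizer at $j$ receives the counterfactual loss vector $\hat\ell_j^t$ whose entry at $a\in A_j$ is $\ell_i^t(j,a)$ plus the sum, over the children $j'$ of $(j,a)$, of the inner product of $\ell_i^t$ with the sequence form, in the subprocess rooted at $j'$, of the strategy played at round $t$; its prediction $\hat m_j^t$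 is obtained in the same way from $m_i^t$ and the strategy of round $t$ below $j$. Claim. Fix the game, the bounds $B_j$, constants $\alpha,\beta,M_0\in\mathbb R$ and $0<c_1\le c_2$. There is a constant $C$ such that for every $T\ge1$ the following holds. Let player $i$ use a parameter $\kappa^{(i)}$ with $c_1T^{-1/4}\le\kappa^{(i)}\le c_2T^{-1/4}$ ($i=1,2$), let $\|m_i^1\|_2\le M_0$, and suppose that every local minimizer is $(\kappa_j,\alpha,\beta)$-stable-predictive on the counterfactual losses and predictions that it receives, where $\kappa_j$ is computed from $\kappa^{(i)}$. Then the averages $\frac1T\sum_{t=1}^Tx^t$ and $\frac1T\sum_{t=1}^Ty^t$ are sequence forms of behavioral strategies, and every profile of behavioral strategies with these sequence forms is a $C\,T^{-3/4}$-Nash equilibrium of the game: no player can raise his expected payoff by more than $C\,T^{-3/4}$ by changing his behavioral strategy. -/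

import Mathlib

open scoped BigOperators

noncomputable section

namespace StablePredictiveCFR

universe u v w

/-! ### Predictive regret minimizers -/

/-- A (deterministic) predictive regret minimizer with decision set `X`. Rounds are numbered from
`0`; the decision at round `t` is a function of the losses of the rounds before `t` and of the
predictions of the rounds up to and including `t`. -/
structure PredictiveRegretMinimizer (E : Type u) (X : Set E) where
  decide : (t : ℕ) → (Fin t → E) → (Fin (t + 1) → E) → E
  decide_mem : ∀ t ℓ m, decide t ℓ m ∈ X

/-- The decision at round `t` when the losses are `ℓ` and the predictions are `m`. -/
def PredictiveRegretMinimizer.decisionAt {E : Type u} {X : Set E}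
    (R : PredictiveRegretMinimizer E X) (ℓ m : ℕ → E) (t : ℕ) : E :=
  R.decide t (fun s => ℓ s) (fun s => m s)

/-- Regret of the decisions `x` in the first `T` rounds relative to the fixed decision `z`. The
cumulative regret is the maximum of this quantity over all feasible `z`. -/
def regretAgainst {E : Type u} [NormedAddCommGroup E] [InnerProductSpace ℝ E]
    (ℓ x : ℕ → E) (T : ℕ) (z : E) : ℝ :=
  ∑ t ∈ Finset.range T, inner ℝ (ℓ t) (x t) - ∑ t ∈ Finset.range T, inner ℝ (ℓ t) z

/-- `R` is `(κ, α, β)`-stable-predictive on the losses `ℓ` and predictions `m` that it receives: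
its decisions move by at most `κ` per round, and for every `T` its cumulative regret (the maximum
over `z ∈ X`) is at most `α / κ + β κ ∑_{t < T} ‖ℓ t - m t‖ ^ 2`. -/
def PredictiveRegretMinimizer.IsStablePredictiveOn {E : Type u} [NormedAddCommGroup E]
    [InnerProductSpace ℝ E] {X : Set E} (R : PredictiveRegretMinimizer E X) (κ α β : ℝ)
    (ℓ m : ℕ → E) : Prop :=
  (∀ t, ‖R.decisionAt ℓ m (t + 1) - R.decisionAt ℓ m t‖ ≤ κ) ∧
  ∀ T, ∀ z ∈ X, regretAgainst ℓ (R.decisionAt ℓ m) T z ≤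
    α / κ + β * κ * ∑ t ∈ Finset.range T, ‖ℓ t - m t‖ ^ 2

/-- The simplex of probability distributions on `S`, in Euclidean space. -/
def simplex (S : Type v) [Fintype S] : Set (EuclideanSpace ℝ S) :=
  {x | (fun a => x a) ∈ stdSimplex ℝ S}

/-! ### Sequential decision processes -/

/-- One probability distribution over the actions at every decision point. -/
abbrev Behavior {J : Type u} (A : J → Type v) [∀ j, Fintype (A j)] : Type (max u v) :=
  ∀ j, stdSimplex ℝ (A j)

/-- A sequential decision process with decision points `J` and action sets `A j`, given by the
list `path j` of pairs (decision point, action) met on the way from the root to `j`. The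
observation node reached after action `a` at `j` is identified with the pair `(j, a)`; the root is
an observation node too, and its children are the points with empty path. -/
structure DecisionProcess (J : Type u) (A : J → Type v) where
  path : J → List (Σ j, A j)
  coherent : ∀ j s σ, path j = s ++ [σ] → path σ.1 = s

namespace DecisionProcess

variable {J : Type u} {A : J → Type v} (Q : DecisionProcess J A)

/-- The whole sequence of decision points and actions that ends with `σ = (j, a)`. -/
def seqTo (σ : Σ j, A j) : List (Σ j, A j) := Q.path σ.1 ++ [σ]

theorem length_le_of_mem_drop {σ τ : Σ j, A j} {n : ℕ} (h : τ ∈ (Q.seqTo σ).drop n) :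
    n ≤ (Q.path τ.1).length := by
  suffices key : ∀ (l s : List (Σ j, A j)) (j : J) (a : A j),
      Q.path j ++ [⟨j, a⟩] = s ++ τ :: l → Q.path τ.1 = s by
    obtain ⟨s, l, hl⟩ := List.append_of_mem h
    have := key l ((Q.seqTo σ).take n ++ s) σ.1 σ.2 (by
      rw [List.append_assoc, ← hl, List.take_append_drop]; rfl)
    have hn : n ≤ (Q.seqTo σ).length := by
      by_contra hc
      rw [List.drop_eq_nil_of_le (by omega)] at h
      simp at h
    rw [this, List.length_append, List.length_take]
    omega
  intro l
  induction l using List.reverseRecOn with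
  | nil =>
    intro s j a hs
    obtain ⟨h1, h2⟩ := List.append_inj' hs rfl
    have h3 : (⟨j, a⟩ : Σ j, A j) = τ := by simpa using h2
    subst h3
    exact h1
  | append_singleton l ρ ih =>
    intro s j a hs
    rw [← List.cons_append, ← List.append_assoc] at hs
    obtain ⟨h1, _⟩ := List.append_inj' hs rfl
    rcases List.eq_nil_or_concat l with rfl | ⟨l', ρ', rfl⟩
    · exact Q.coherent _ _ _ h1
    · have h2 := Q.coherent j (s ++ τ :: l') ρ' (by rw [h1]; simp)
      exact ih s ρ'.1 ρ'.2 (by rw [h2]; simp)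

variable [Fintype J]

open Classical in
/-- The decision points that directly follow the observation node `σ = (j, a)`. -/
def children (σ : Σ j, A j) : Finset J := Finset.univ.filter fun j' => Q.path j' = Q.seqTo σ

open Classical in
/-- The first decision points. -/
def initial : Finset J := Finset.univ.filter fun j => Q.path j = []

variable [∀ j, Fintype (A j)]

/-- Sequence form of a behavioral strategy: a sequence gets the product of the probabilities of
its actions. -/
def seqForm (b : Behavior A) : EuclideanSpace ℝ (Σ j, A j) :=
  WithLp.toLp 2 fun σ => ((Q.seqTo σ).map fun τ => (b τ.1).1 τ.2).prod

open Classical in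
/-- Sequence form of `b` in the subprocess rooted at `j`, padded by zeros: a sequence at or below
`j` gets the product of the probabilities of its actions from `j` on. -/
def subSeqForm (j : J) (b : Behavior A) : EuclideanSpace ℝ (Σ j, A j) :=
  WithLp.toLp 2 fun σ =>
    if ∃ a, Q.seqTo ⟨j, a⟩ <+: Q.seqTo σ then
      (((Q.seqTo σ).drop (Q.path j).length).map fun τ => (b τ.1).1 τ.2).prod
    else 0

/-- The counterfactual vector at decision point `j` of a vector `v` (a loss or a prediction), when
play below `j` follows `b`. -/
def counterfactual (v : EuclideanSpace ℝ (Σ j, A j)) (b : Behavior A) (j : J) :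
    EuclideanSpace ℝ (A j) :=
  WithLp.toLp 2 fun a =>
    v ⟨j, a⟩ + ∑ j' ∈ Q.children ⟨j, a⟩, inner ℝ v (Q.subSeqForm j' b)

/-- The scalar `γ_j`: it is `κ` at the root, is divided by `2 √n` when passing a decision point
with `n` actions, and by `√n` when passing an observation node with `n` children. -/
def gamma (κ : ℝ) (j : J) : ℝ :=
  κ / √(Q.initial.card : ℝ) *
    ((Q.path j).map fun σ =>
      1 / (2 * √(Fintype.card (A σ.1) : ℝ)) * (1 / √((Q.children σ).card : ℝ))).prod

/-- The stability parameter `κ_j` of the local regret minimizer at `j`. -/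
def localStability (B : J → ℝ) (κ : ℝ) (j : J) : ℝ :=
  Q.gamma κ j / (2 * √(Fintype.card (A j) : ℝ) * B j)

end DecisionProcess

/-! ### Two-player zero-sum extensive-form games -/

/-- A finite game tree. `I i` is the set of information sets of player `i` and `A i h` the set of
actions at `h`; the number at a leaf is the payoff to player `0`, and its negative is the payoff to
player `1`. -/
inductive GameTree (I : Fin 2 → Type u) (A : ∀ i, I i → Type v) : Type (max u v)
  | leaf (payoff : ℝ) : GameTree I A
  | chance (n : ℕ) (p : stdSimplex ℝ (Fin n)) (next : Fin n → GameTree I A) : GameTree I A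
  | decision (i : Fin 2) (h : I i) (next : A i h → GameTree I A) : GameTree I A

/-- For each player, the list of his own past information sets and actions. -/
abbrev History {I : Fin 2 → Type u} (A : ∀ i, I i → Type v) : Type (max u v) :=
  ∀ i, List (Σ h, A i h)

/-- Player `i` takes action `a` at `h`. -/
def History.extend {I : Fin 2 → Type u} {A : ∀ i, I i → Type v} (q : History A) (i : Fin 2)
    (h : I i) (a : A i h) : History A :=
  Function.update q i (q i ++ [⟨h, a⟩])

namespace GameTree

variable {I : Fin 2 → Type u} {A : ∀ i, I i → Type v}

/-- `G.Occurs i h s q`: if `G` is entered with history `q`, then it has a node in the information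
set `h` of player `i` at which his own history is `s`. -/
def Occurs (i : Fin 2) (h : I i) (s : List (Σ h, A i h)) : GameTree I A → History A → Prop
  | leaf _, _ => False
  | chance _ _ next, q => ∃ k, Occurs i h s (next k) q
  | decision i' h' next, q =>
      ((⟨i', h'⟩ : Σ i, I i) = ⟨i, h⟩ ∧ q i = s) ∨
        ∃ a, Occurs i h s (next a) (q.extend i' h' a)

variable [∀ i h, Fintype (A i h)]

/-- Expected payoff to player `0` under a profile of behavioral strategies. -/
def expectedPayoff (b : ∀ i, Behavior (A i)) : GameTree I A → ℝ
  | leaf r => r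
  | chance _ p next => ∑ k, p.1 k * expectedPayoff b (next k)
  | decision i h next => ∑ a, (b i h).1 a * expectedPayoff b (next a)

open Classical in
/-- The matrix of leaf payoffs, weighted by the chance probabilities. Rows and columns are the
last sequences of the players; `none` is the empty sequence. -/
def payoffMatrix : GameTree I A → History A →
    Matrix (Option (Σ h, A 0 h)) (Option (Σ h, A 1 h)) ℝ
  | leaf r, q => fun s s' => if (q 0).getLast? = s ∧ (q 1).getLast? = s' then r else 0
  | chance _ p next, q => ∑ k, p.1 k • payoffMatrix (next k) q
  | decision i h next, q => ∑ a, payoffMatrix (next a) (q.extend i h a)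

end GameTree

theorem GameTree.Occurs.pred {I : Fin 2 → Type u} {A : ∀ i, I i → Type v} {i : Fin 2} {h : I i}
    {s : List (Σ h, A i h)} {σ : Σ h, A i h} {G : GameTree I A} :
    ∀ {q : History A}, G.Occurs i h (s ++ [σ]) q → q i = s ++ [σ] ∨ G.Occurs i σ.1 s q := by
  induction G with
  | leaf r => intro q H; exact H.elim
  | chance n p next ih =>
    rintro q ⟨k, hk⟩
    exact (ih k hk).imp_right fun H => ⟨k, H⟩
  | decision i' h' next ih =>
    rintro q (⟨_, hq⟩ | ⟨a, ha⟩)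
    · exact Or.inl hq
    · rcases ih a ha with H | H
      · by_cases hi : i' = i
        · subst hi
          simp only [History.extend, Function.update_self] at H
          obtain ⟨h1, h2⟩ := List.append_inj' H rfl
          have h3 : σ = ⟨h', a⟩ := by simpa using h2.symm
          subst h3
          exact Or.inr (Or.inl ⟨rfl, h1⟩)
        · left
          rwa [History.extend, Function.update_of_ne (Ne.symm hi)] at H
      · exact Or.inr (Or.inr ⟨a, H⟩)

/-- A two-player zero-sum extensive-form game with perfect recall: at all nodes of one information
set, the player to move has the same own history of information sets and actions. Information sets
are nonempty sets of nodes. -/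
structure ExtensiveGame (I : Fin 2 → Type u) (A : ∀ i, I i → Type v) where
  tree : GameTree I A
  occurs : ∀ i (h : I i), ∃ s, tree.Occurs i h s fun _ => []
  perfectRecall : ∀ i (h : I i) s s',
    (tree.Occurs i h s fun _ => []) → (tree.Occurs i h s' fun _ => []) → s = s'

namespace ExtensiveGame

variable {I : Fin 2 → Type u} {A : ∀ i, I i → Type v} (G : ExtensiveGame I A)

/-- The sequential decision process faced by player `i`: the decision points are his information
sets, and the path to one of them is his own history there. -/
def process (i : Fin 2) : DecisionProcess (I i) (A i) where
  path h := (G.occurs i h).choose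
  coherent h s σ hs := by
    have H := (G.occurs i h).choose_spec
    rw [hs] at H
    rcases H.pred with H | H
    · simp at H
    · exact G.perfectRecall i σ.1 _ _ (G.occurs i σ.1).choose_spec H

variable [∀ i h, Fintype (A i h)]

/-- Expected payoff to player `i`. -/
def utility (i : Fin 2) (b : ∀ i, Behavior (A i)) : ℝ :=
  if i = 0 then G.tree.expectedPayoff b else -G.tree.expectedPayoff b

/-- `b` is an `ε`-Nash equilibrium: no player gains more than `ε` by deviating. -/
def IsNash (ε : ℝ) (b : ∀ i, Behavior (A i)) : Prop :=
  ∀ i (b' : Behavior (A i)), G.utility i (Function.update b i b') ≤ G.utility i b + ε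

variable [∀ i, Fintype (I i)]

/-- A sequence-form vector together with the weight `1` of the empty sequence. -/
def withEmpty {S : Type w} (x : EuclideanSpace ℝ S) : Option S → ℝ :=
  fun o => o.elim 1 fun σ => x σ

open Matrix in
/-- The loss vectors of the two players when they play the sequence-form strategies `x 0`, `x 1`:
`-M y` for player `0` and `Mᵀ x` for player `1`, where `M` is the payoff matrix. -/
def loss (x : ∀ i, EuclideanSpace ℝ (Σ h, A i h)) : ∀ i, EuclideanSpace ℝ (Σ h, A i h)
  | 0 => WithLp.toLp 2 fun σ =>
      -((G.tree.payoffMatrix fun _ => []) *ᵥ withEmpty (x 1)) (some σ)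
  | 1 => WithLp.toLp 2 fun σ =>
      ((G.tree.payoffMatrix fun _ => [])ᵀ *ᵥ withEmpty (x 0)) (some σ)

/-- The loss of player `i` at round `t`, when `b t` is the profile played at round `t`. -/
def roundLoss (b : ℕ → ∀ i, Behavior (A i)) (i : Fin 2) (t : ℕ) :
    EuclideanSpace ℝ (Σ h, A i h) :=
  G.loss (fun i => (G.process i).seqForm (b t i)) i

/-- The prediction given to player `i` at round `t`: the previous loss, and `m₀ i` at the first
round. -/
def roundPrediction (m₀ : ∀ i, EuclideanSpace ℝ (Σ h, A i h)) (b : ℕ → ∀ i, Behavior (A i))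
    (i : Fin 2) : ℕ → EuclideanSpace ℝ (Σ h, A i h)
  | 0 => m₀ i
  | t + 1 => G.roundLoss b i t

/-- The counterfactual loss vectors of the local regret minimizer at `h`. -/
def localLoss (b : ℕ → ∀ i, Behavior (A i)) (i : Fin 2) (h : I i) (t : ℕ) :
    EuclideanSpace ℝ (A i h) :=
  (G.process i).counterfactual (G.roundLoss b i t) (b t i) h

/-- The counterfactual predictions of the local regret minimizer at `h`. -/
def localPrediction (m₀ : ∀ i, EuclideanSpace ℝ (Σ h, A i h)) (b : ℕ → ∀ i, Behavior (A i))
    (i : Fin 2) (h : I i) (t : ℕ) : EuclideanSpace ℝ (A i h) :=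
  (G.process i).counterfactual (G.roundPrediction m₀ b i t) (b t i) h

/-- `b` is the sequence of profiles played when both players run counterfactual regret
minimization with the local regret minimizers `R` against each other. -/
def IsSelfPlay (R : ∀ i (h : I i), PredictiveRegretMinimizer _ (simplex (A i h)))
    (m₀ : ∀ i, EuclideanSpace ℝ (Σ h, A i h)) (b : ℕ → ∀ i, Behavior (A i)) : Prop :=
  ∀ t i h, WithLp.toLp 2 (b t i h).1 =
    (R i h).decisionAt (G.localLoss b i h) (G.localPrediction m₀ b i h) t

/-- Self-play is well defined: the decision at `h` in round `t` depends only on earlier rounds and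
on the decisions of round `t` strictly below `h`. -/
theorem exists_isSelfPlay (R : ∀ i (h : I i), PredictiveRegretMinimizer _ (simplex (A i h)))
    (m₀ : ∀ i, EuclideanSpace ℝ (Σ h, A i h)) : ∃ b, G.IsSelfPlay R m₀ b := by
  let N : ℕ := ∑ i, ∑ h, ((G.process i).path h).length
  have hN : ∀ i h, ((G.process i).path h).length ≤ N := fun i h =>
    (Finset.single_le_sum (f := fun h => ((G.process i).path h).length)
      (fun _ _ => Nat.zero_le _) (Finset.mem_univ h)).trans
    (Finset.single_le_sum (f := fun i => ∑ h, ((G.process i).path h).length)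
      (fun _ _ => Nat.zero_le _) (Finset.mem_univ i))
  let μ : (ℕ × Σ i, I i) → ℕ := fun k =>
    k.1 * (N + 1) + (N - ((G.process k.2.1).path k.2.2).length)
  let F : (k : ℕ × Σ i, I i) → (ℕ → ∀ i, Behavior (A i)) → stdSimplex ℝ (A k.2.1 k.2.2) :=
    fun k b => ⟨fun a => (R k.2.1 k.2.2).decisionAt (G.localLoss b k.2.1 k.2.2)
      (G.localPrediction m₀ b k.2.1 k.2.2) k.1 a, (R k.2.1 k.2.2).decide_mem _ _ _⟩
  let d : (k : ℕ × Σ i, I i) → stdSimplex ℝ (A k.2.1 k.2.2) := fun k =>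
    ⟨fun a => (R k.2.1 k.2.2).decide 0 (fun _ => 0) (fun _ => 0) a, (R k.2.1 k.2.2).decide_mem _ _ _⟩
  let f : (k : ℕ × Σ i, I i) → stdSimplex ℝ (A k.2.1 k.2.2) :=
    (measure μ).wf.fix fun k rec => F k fun t i h =>
      if hk : μ (t, ⟨i, h⟩) < μ k then rec (t, ⟨i, h⟩) hk else d (t, ⟨i, h⟩)
  have hf : ∀ k, f k = F k fun t i h =>
      if μ (t, ⟨i, h⟩) < μ k then f (t, ⟨i, h⟩) else d (t, ⟨i, h⟩) := by
    intro k
    simp only [f]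
    rw [WellFounded.fix_eq]
    simp only [dite_eq_ite]
  refine ⟨fun t i h => f (t, ⟨i, h⟩), fun t i h => ?_⟩
  change WithLp.toLp 2 (f (t, ⟨i, h⟩)).1 = _
  rw [hf (t, ⟨i, h⟩)]
  simp only [F]
  change PredictiveRegretMinimizer.decisionAt _ _ _ _ = _
  set b : ℕ → ∀ i, Behavior (A i) := fun t i h => f (t, ⟨i, h⟩) with hb
  set b' : ℕ → ∀ i, Behavior (A i) := fun t' i' h' =>
    if μ (t', ⟨i', h'⟩) < μ (t, ⟨i, h⟩) then f (t', ⟨i', h'⟩) else d (t', ⟨i', h'⟩) with hb'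
  have past : ∀ s < t, b' s = b s := by
    intro s hs
    funext i' h'
    simp only [hb, hb']
    rw [if_pos]
    simp only [μ]
    have h1 : (s + 1) * (N + 1) ≤ t * (N + 1) := Nat.mul_le_mul_right _ hs
    rw [Nat.add_mul] at h1
    omega
  have loss_past : ∀ s < t, G.roundLoss b' i s = G.roundLoss b i s := by
    intro s hs
    simp only [roundLoss, past s hs]
  have below : ∀ j' σ, ((G.process i).path h).length < ((G.process i).path j').length →
      ∀ τ ∈ ((G.process i).seqTo σ).drop ((G.process i).path j').length,
        b' t i τ.1 = b t i τ.1 := by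
    intro j' σ hj' τ hτ
    have hlen := (G.process i).length_le_of_mem_drop hτ
    simp only [hb, hb']
    rw [if_pos]
    simp only [μ]
    have := hN i τ.1
    omega
  have pred_eq : ∀ s ≤ t, G.localPrediction m₀ b' i h s = G.localPrediction m₀ b i h s := by
    intro s hs
    have hm : G.roundPrediction m₀ b' i s = G.roundPrediction m₀ b i s := by
      cases s with
      | zero => rfl
      | succ s => exact loss_past s hs
    simp only [localPrediction, hm]
    rcases hs.lt_or_eq with hs | rfl
    · rw [past s hs]
    · ext a
      simp only [DecisionProcess.counterfactual]
      congr 1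
      refine Finset.sum_congr rfl fun j' hj' => ?_
      congr 1
      ext σ
      simp only [DecisionProcess.subSeqForm]
      split_ifs with hσ
      · congr 1
        refine List.map_congr_left fun τ hτ => ?_
        rw [below j' σ ?_ τ hτ]
        simp only [DecisionProcess.children, Finset.mem_filter] at hj'
        rw [hj'.2]
        simp [DecisionProcess.seqTo]
      · rfl
  unfold PredictiveRegretMinimizer.decisionAt
  congr 1
  · funext s
    simp only [localLoss, loss_past s s.2, past s s.2]
  · funext s
    exact pred_eq s (Nat.lt_succ_iff.mp s.2)

end ExtensiveGame

end StablePredictiveCFR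

end

/-! Put `τ = T ^ (-1/4)`, so that `T * τ ^ 4 = 1`. The argument balances the two terms of the local
regret bounds.

Stability gives small prediction errors. Each `κ_j` is a game-dependent multiple of `κ`, hence O(τ).
So all local strategies move by O(τ) per round. So do the sequence forms, as products of boundedly
many probabilities, and the losses, which are affine in the opponent's sequence form
(`exists_norm_loss_seqForm_sub_le`). As the prediction is the previous loss, every prediction error
after the first round is O(τ), and the first is O(1). The counterfactual map is linear and bounded,
so this passes to each decision point. The local regrets are therefore O(1/τ) + O(τ) (O(1) + T
O(τ²)) = O(1/τ).

Local regrets control global regret. The regret against `z` is exactly the sum of the local regrets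
weighted by the probabilities with which `z` reaches the decision points
(`inner_seqForm_sub_inner_seqForm`), and these weights lie in [0, 1]. Hence each player has regret
O(1/τ) (`exists_regret_le`).

Low regret gives equilibrium. By perfect recall the expected payoff is the form of the payoff matrix
in the two sequence forms (`expectedPayoff_eq`). Adding the two regrets bounds the saddle-point gap
of the averages by O(1/(τ T)) = O(τ ^ 3) (`isNash_of_regret_le`). -/

namespace StablePredictiveCFR

/-! ### Products of action probabilities -/

namespace Behavior

variable {J : Type*} {A : J → Type*} [∀ j, Fintype (A j)]

/-- The product of the probabilities of the actions in a list. -/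
def weight (b : Behavior A) (l : List (Σ j, A j)) : ℝ :=
  (l.map fun τ => (b τ.1).1 τ.2).prod

@[simp] theorem weight_nil (b : Behavior A) : b.weight [] = 1 := rfl

theorem weight_cons (b : Behavior A) (τ : Σ j, A j) (l : List (Σ j, A j)) :
    b.weight (τ :: l) = (b τ.1).1 τ.2 * b.weight l := by simp [weight]

theorem weight_concat (b : Behavior A) (l : List (Σ j, A j)) (τ : Σ j, A j) :
    b.weight (l ++ [τ]) = b.weight l * (b τ.1).1 τ.2 := by simp [weight]

theorem prob_nonneg (b : Behavior A) (j : J) (a : A j) : 0 ≤ (b j).1 a := (b j).2.1 a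

theorem sum_prob (b : Behavior A) (j : J) : ∑ a, (b j).1 a = 1 := (b j).2.2

theorem prob_le_one (b : Behavior A) (j : J) (a : A j) : (b j).1 a ≤ 1 := by
  rw [← b.sum_prob j]
  exact Finset.single_le_sum (fun a _ => b.prob_nonneg j a) (Finset.mem_univ a)

theorem weight_nonneg (b : Behavior A) (l : List (Σ j, A j)) : 0 ≤ b.weight l := by
  induction l with
  | nil => simp
  | cons τ l ih => rw [weight_cons]; exact mul_nonneg (b.prob_nonneg _ _) ih

theorem weight_le_one (b : Behavior A) (l : List (Σ j, A j)) : b.weight l ≤ 1 := by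
  induction l with
  | nil => simp
  | cons τ l ih => rw [weight_cons]; exact mul_le_one₀ (b.prob_le_one _ _) (b.weight_nonneg l) ih

/-- Exchanging the factors one at a time costs at most `δ` each, because all the other factors lie
in [0, 1]. -/
theorem abs_weight_sub_le {b b' : Behavior A} {δ : ℝ}
    (h : ∀ j a, |(b j).1 a - (b' j).1 a| ≤ δ) (l : List (Σ j, A j)) :
    |b.weight l - b'.weight l| ≤ l.length * δ := by
  induction l with
  | nil => simp
  | cons τ l ih =>
    have e : b.weight (τ :: l) - b'.weight (τ :: l) =
        (b τ.1).1 τ.2 * (b.weight l - b'.weight l) +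
          ((b τ.1).1 τ.2 - (b' τ.1).1 τ.2) * b'.weight l := by
      rw [weight_cons, weight_cons]; ring
    rw [e]
    refine (abs_add_le _ _).trans ?_
    rw [abs_mul, abs_mul, abs_of_nonneg (b.prob_nonneg _ _), abs_of_nonneg (b'.weight_nonneg l)]
    have h1 := mul_le_of_le_one_left (abs_nonneg (b.weight l - b'.weight l))
      (b.prob_le_one τ.1 τ.2)
    have h2 := mul_le_of_le_one_right (abs_nonneg ((b τ.1).1 τ.2 - (b' τ.1).1 τ.2))
      (b'.weight_le_one l)
    have h3 := h τ.1 τ.2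
    push_cast [List.length_cons]
    linarith

end Behavior

theorem norm_le_card_mul {S : Type*} [Fintype S] {x : EuclideanSpace ℝ S} {c : ℝ}
    (h : ∀ s, |x s| ≤ c) : ‖x‖ ≤ Fintype.card S * c := by
  classical
  calc ‖x‖ = ‖∑ s, EuclideanSpace.single s (x s)‖ := by
        congr 1
        ext s
        simp [Pi.single_apply]
    _ ≤ ∑ s, ‖EuclideanSpace.single s (x s)‖ := norm_sum_le _ _
    _ ≤ ∑ _s : S, c := Finset.sum_le_sum fun s _ => by simpa using h s
    _ = Fintype.card S * c := by simp

/-! ### Sequence forms and the decomposition of regret -/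

namespace DecisionProcess

variable {J : Type*} {A : J → Type*} (Q : DecisionProcess J A)

/-- `coherent` speaks only of the last pair of a path; induction from the end of the list carries it
to every position. -/
theorem path_eq_of_seqTo_eq (l : List (Σ j, A j)) :
    ∀ {σ τ : Σ j, A j} {s : List (Σ j, A j)}, Q.seqTo σ = s ++ τ :: l → Q.path τ.1 = s := by
  induction l using List.reverseRecOn with
  | nil =>
    intro σ τ s hs
    obtain ⟨h1, h2⟩ := List.append_inj' hs rfl
    have h3 : σ = τ := by simpa using h2
    subst h3
    exact h1
  | append_singleton l ρ ih =>
    intro σ τ s hs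
    rw [← List.cons_append, ← List.append_assoc] at hs
    obtain ⟨h1, _⟩ := List.append_inj' hs rfl
    rcases List.eq_nil_or_concat l with rfl | ⟨l', ρ', rfl⟩
    · exact Q.coherent _ _ _ h1
    · have h2 := Q.coherent σ.1 (s ++ τ :: l') ρ' (by rw [h1]; simp)
      exact ih (σ := ρ') (by simp [seqTo, h2])

theorem eq_of_seqTo_eq {σ τ : Σ j, A j} (h : Q.seqTo σ = Q.seqTo τ) : σ = τ := by
  simpa using (List.append_inj' h rfl).2

variable [∀ j, Fintype (A j)]

theorem seqForm_apply (b : Behavior A) (σ : Σ j, A j) :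
    Q.seqForm b σ = b.weight (Q.path σ.1) * (b σ.1).1 σ.2 := by
  change b.weight (Q.path σ.1 ++ [σ]) = _
  rw [Behavior.weight_concat]

theorem seqForm_eq_weight (b : Behavior A) (σ : Σ j, A j) :
    Q.seqForm b σ = b.weight (Q.seqTo σ) := rfl

open Classical in
theorem subSeqForm_of_eq (b : Behavior A) {σ τ : Σ j, A j} {s l : List (Σ j, A j)}
    (h : Q.seqTo σ = s ++ τ :: l) : Q.subSeqForm τ.1 b σ = b.weight (τ :: l) := by
  have hp := Q.path_eq_of_seqTo_eq l h
  have hex : ∃ a, Q.seqTo ⟨τ.1, a⟩ <+: Q.seqTo σ := ⟨τ.2, l, by rw [h, ← hp]; simp [seqTo]⟩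
  change (if _ then b.weight _ else 0) = _
  rw [if_pos hex, h, hp, List.drop_left]

open Classical in
theorem subSeqForm_eq_zero (b : Behavior A) {σ : Σ j, A j} {j : J}
    (h : ∀ a l, Q.seqTo σ ≠ Q.path j ++ ⟨j, a⟩ :: l) : Q.subSeqForm j b σ = 0 := by
  change (if _ then b.weight _ else 0) = _
  rw [if_neg]
  rintro ⟨a, l, hl⟩
  exact h a l (by rw [← hl]; simp [seqTo])

theorem abs_seqForm_le_one (b : Behavior A) (σ : Σ j, A j) : |Q.seqForm b σ| ≤ 1 := by
  rw [seqForm_eq_weight, abs_of_nonneg (b.weight_nonneg _)]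
  exact b.weight_le_one _

/-- Averages of sequence forms of behavioral strategies are sequence forms. -/
theorem exists_seqForm_eq_average {T : ℕ} (hT : 1 ≤ T) (b : ℕ → Behavior A) :
    ∃ z : Behavior A, Q.seqForm z = (1 / (T : ℝ)) • ∑ t ∈ Finset.range T, Q.seqForm (b t) := by
  classical
  have hT' : (T : ℝ) ≠ 0 := by positivity
  -- `W j` is `T` times the average reach probability of `j`. The strategy `z` averages the local
  -- strategies with these reach weights; at points never reached any choice works, and `b 0 j` is
  -- taken.
  let W : J → ℝ := fun j => ∑ t ∈ Finset.range T, (b t).weight (Q.path j)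
  have hW0 : ∀ j, 0 ≤ W j := fun j => Finset.sum_nonneg fun t _ => (b t).weight_nonneg _
  let z : Behavior A := fun j =>
    if h : W j = 0 then b 0 j else
      ⟨fun a => (∑ t ∈ Finset.range T, (b t).weight (Q.path j) * (b t j).1 a) / W j,
        fun a => div_nonneg (Finset.sum_nonneg fun t _ =>
          mul_nonneg ((b t).weight_nonneg _) ((b t).prob_nonneg j a)) (hW0 j), by
        rw [← Finset.sum_div, Finset.sum_comm]
        simp only [← Finset.mul_sum, Behavior.sum_prob, mul_one]
        exact div_self h⟩
  have step : ∀ j a, W j * (z j).1 a =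
      ∑ t ∈ Finset.range T, (b t).weight (Q.path j) * (b t j).1 a := by
    intro j a
    by_cases h : W j = 0
    · rw [h, zero_mul, Finset.sum_eq_zero]
      intro t ht
      rw [(Finset.sum_eq_zero_iff_of_nonneg fun t _ => (b t).weight_nonneg _).1 h t ht, zero_mul]
    · simp only [z, dif_neg h]
      field_simp
  have key : ∀ (n : ℕ) (j : J), (Q.path j).length = n → T * z.weight (Q.path j) = W j := by
    intro n
    induction n with
    | zero =>
      intro j hj
      have : Q.path j = [] := List.length_eq_zero_iff.1 hj
      simp [W, this]
    | succ n ih =>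
      intro j hj
      rcases List.eq_nil_or_concat (Q.path j) with h | ⟨s, τ, h⟩
      · simp [h] at hj
      rw [List.concat_eq_append] at h
      have hs := Q.coherent j s τ h
      have hl : (Q.path τ.1).length = n := by
        rw [hs]; simp [h] at hj; exact hj
      simp only [W, h, Behavior.weight_concat]
      rw [← hs, ← step, ← ih τ.1 hl]
      ring
  refine ⟨z, ?_⟩
  ext σ
  have h1 := key _ σ.1 rfl
  have h2 := step σ.1 σ.2
  rw [← h1] at h2
  simp only [PiLp.smul_apply, WithLp.ofLp_sum, Finset.sum_apply, seqForm_apply, smul_eq_mul]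
  rw [← h2]
  field_simp

variable [Fintype J]

/-- Only the first decision point on the way to `σ` contributes to the sum. -/
theorem seqForm_eq_sum_initial (b : Behavior A) (σ : Σ j, A j) :
    Q.seqForm b σ = ∑ j ∈ Q.initial, Q.subSeqForm j b σ := by
  rcases hL : Q.seqTo σ with _ | ⟨τ, l⟩
  · simp [seqTo] at hL
  have hp : Q.path τ.1 = [] := Q.path_eq_of_seqTo_eq l (s := []) (by rw [hL]; rfl)
  rw [Finset.sum_eq_single τ.1]
  · rw [Q.subSeqForm_of_eq b (s := []) hL, ← hL]; rfl
  · intro j hj hne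
    have hj' : Q.path j = [] := by simpa [initial] using hj
    refine Q.subSeqForm_eq_zero b fun a l' h => hne ?_
    rw [hL, hj'] at h
    have := (List.cons.inj h).1
    rw [this]
  · intro h; simp [initial, hp] at h

open Classical in
-- A sequence at or below `j` uses exactly one action `a` at `j`, and then either ends there or
-- continues through exactly one child of `(j, a)`. So at most one term on the right survives.
theorem subSeqForm_rec (b : Behavior A) (j : J) (σ : Σ j, A j) :
    Q.subSeqForm j b σ = ∑ a, (b j).1 a * ((if σ = ⟨j, a⟩ then 1 else 0) +
      ∑ j' ∈ Q.children ⟨j, a⟩, Q.subSeqForm j' b σ) := by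
  by_cases hex : ∃ a l, Q.seqTo σ = Q.path j ++ ⟨j, a⟩ :: l
  · obtain ⟨a, l, h⟩ := hex
    have hzero : ∀ a' ≠ a, (if σ = ⟨j, a'⟩ then (1 : ℝ) else 0) +
        ∑ j' ∈ Q.children ⟨j, a'⟩, Q.subSeqForm j' b σ = 0 := by
      intro a' ha'
      have h1 : σ ≠ ⟨j, a'⟩ := by
        rintro rfl
        simp only [seqTo] at h
        have := List.append_cancel_left h
        simp at this
        exact ha' this.1
      rw [if_neg h1, zero_add]
      refine Finset.sum_eq_zero fun j' hj' => Q.subSeqForm_eq_zero b fun a'' l' h' => ?_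
      have hc : Q.path j' = Q.seqTo ⟨j, a'⟩ := by simpa [children] using hj'
      rw [h, hc, seqTo, List.append_assoc] at h'
      have := List.append_cancel_left h'
      simp at this
      exact ha' this.1.symm
    rw [Finset.sum_eq_single a (fun a' _ ha' => by rw [hzero a' ha', mul_zero]) (by simp),
      Q.subSeqForm_of_eq b (τ := ⟨j, a⟩) h, Behavior.weight_cons]
    congr 1
    rcases l with _ | ⟨ρ, l⟩
    · have hσ : σ = ⟨j, a⟩ := Q.eq_of_seqTo_eq (by rw [h]; rfl)
      rw [if_pos hσ, Finset.sum_eq_zero]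
      · simp
      · intro j' hj'
        refine Q.subSeqForm_eq_zero b fun a'' l' h' => ?_
        have hc : Q.path j' = Q.seqTo ⟨j, a⟩ := by simpa [children] using hj'
        rw [h, hc, seqTo] at h'
        have := congrArg List.length h'
        simp at this
    · have hσ : σ ≠ ⟨j, a⟩ := by
        rintro rfl
        have := congrArg List.length h
        simp [seqTo] at this
      have h2 : Q.seqTo σ = Q.seqTo ⟨j, a⟩ ++ ρ :: l := by rw [h]; simp [seqTo]
      have hp := Q.path_eq_of_seqTo_eq l h2
      rw [if_neg hσ, zero_add, Finset.sum_eq_single ρ.1]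
      · rw [Q.subSeqForm_of_eq b h2]
      · intro j' hj' hne
        refine Q.subSeqForm_eq_zero b fun a'' l' h' => hne ?_
        have hc : Q.path j' = Q.seqTo ⟨j, a⟩ := by simpa [children] using hj'
        rw [h2, hc] at h'
        have := (List.cons.inj (List.append_cancel_left h')).1
        rw [this]
      · intro hn; simp [children, hp] at hn
  · push Not at hex
    rw [Q.subSeqForm_eq_zero b hex]
    symm
    refine Finset.sum_eq_zero fun a _ => ?_
    have h1 : σ ≠ ⟨j, a⟩ := by rintro rfl; exact hex a [] rfl
    rw [if_neg h1, zero_add, Finset.sum_eq_zero, mul_zero]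
    intro j' hj'
    refine Q.subSeqForm_eq_zero b fun a'' l' h' => ?_
    have hc : Q.path j' = Q.seqTo ⟨j, a⟩ := by simpa [children] using hj'
    rw [hc] at h'
    exact hex a (⟨j', a''⟩ :: l') (by rw [h']; simp [seqTo])

theorem inner_seqForm_eq_sum_initial (v : EuclideanSpace ℝ (Σ j, A j)) (b : Behavior A) :
    inner ℝ v (Q.seqForm b) = ∑ j ∈ Q.initial, inner ℝ v (Q.subSeqForm j b) := by
  rw [← inner_sum]
  congr 1
  ext σ
  rw [seqForm_eq_sum_initial]
  simp

/-- This is what the counterfactual vector is made for: its mean under the strategy at `j` is the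
value of the whole subprocess. -/
theorem inner_subSeqForm (v : EuclideanSpace ℝ (Σ j, A j)) (b : Behavior A) (j : J) :
    inner ℝ v (Q.subSeqForm j b) = ∑ a, (b j).1 a * Q.counterfactual v b j a := by
  classical
  have e : Q.subSeqForm j b = ∑ a, (b j).1 a • (EuclideanSpace.single (⟨j, a⟩ : Σ j, A j) (1 : ℝ) +
      ∑ j' ∈ Q.children ⟨j, a⟩, Q.subSeqForm j' b) := by
    ext σ
    rw [subSeqForm_rec]
    simp [Pi.single_apply, mul_add]
  rw [e, inner_sum]
  refine Finset.sum_congr rfl fun a _ => ?_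
  rw [inner_smul_right, inner_add_right, inner_sum]
  simp [counterfactual, EuclideanSpace.inner_single_right]

/-- The regret of `b` against `z` is the sum of the local regrets, weighted by the probabilities
with which `z` reaches the decision points. -/
theorem inner_seqForm_sub_inner_seqForm (v : EuclideanSpace ℝ (Σ j, A j)) (b z : Behavior A) :
    inner ℝ v (Q.seqForm b) - inner ℝ v (Q.seqForm z) =
      ∑ j, z.weight (Q.path j) * (inner ℝ (Q.counterfactual v b j) (WithLp.toLp 2 (b j).1) -
        inner ℝ (Q.counterfactual v b j) (WithLp.toLp 2 (z j).1)) := by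
  classical
  have hb : ∀ j, inner ℝ (Q.counterfactual v b j) (WithLp.toLp 2 (b j).1) =
      inner ℝ v (Q.subSeqForm j b) := by
    intro j
    rw [inner_subSeqForm]
    simp [PiLp.inner_apply]
  have hz : ∀ j, z.weight (Q.path j) * inner ℝ (Q.counterfactual v b j) (WithLp.toLp 2 (z j).1) =
      ∑ a, (Q.seqForm z ⟨j, a⟩ * v ⟨j, a⟩ + ∑ j' ∈ Q.children ⟨j, a⟩,
        z.weight (Q.path j') * inner ℝ v (Q.subSeqForm j' b)) := by
    intro j
    rw [PiLp.inner_apply, Finset.mul_sum]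
    refine Finset.sum_congr rfl fun a _ => ?_
    have hc : ∀ j' ∈ Q.children ⟨j, a⟩, z.weight (Q.path j') * inner ℝ v (Q.subSeqForm j' b) =
        Q.seqForm z ⟨j, a⟩ * inner ℝ v (Q.subSeqForm j' b) := by
      intro j' hj'
      have : Q.path j' = Q.seqTo ⟨j, a⟩ := by simpa [children] using hj'
      rw [this, seqForm_eq_weight]
    rw [Finset.sum_congr rfl hc, ← Finset.mul_sum, seqForm_apply]
    simp [counterfactual]
    ring
  -- Each decision point is either initial or a child of exactly one pair. Regrouping the sum by
  -- parents leaves a non-initial part that cancels against the children terms of `hz`.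
  have hsplit : ∑ j, z.weight (Q.path j) * inner ℝ v (Q.subSeqForm j b) =
      ∑ j ∈ Q.initial, inner ℝ v (Q.subSeqForm j b) +
        ∑ j, ∑ a, ∑ j' ∈ Q.children ⟨j, a⟩,
          z.weight (Q.path j') * inner ℝ v (Q.subSeqForm j' b) := by
    rw [← Fintype.sum_sigma' (f := fun j a => ∑ j' ∈ Q.children ⟨j, a⟩,
          z.weight (Q.path j') * inner ℝ v (Q.subSeqForm j' b))]
    simp only [initial, children, Finset.sum_filter]
    rw [Finset.sum_comm, ← Finset.sum_add_distrib]
    refine Finset.sum_congr rfl fun j _ => ?_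
    rcases List.eq_nil_or_concat (Q.path j) with h | ⟨s, τ, h⟩
    · rw [if_pos h, Finset.sum_eq_zero]
      · simp [h]
      · intro σ _
        rw [if_neg]
        simp [h, seqTo]
    · have hτ : Q.path j = Q.seqTo τ := by
        rw [List.concat_eq_append] at h
        rw [h, seqTo, Q.coherent j s τ h]
      rw [if_neg (by rw [h]; simp), Finset.sum_eq_single τ]
      · simp [hτ]
      · intro σ _ hne
        rw [if_neg]
        intro h'
        exact hne (Q.eq_of_seqTo_eq (h'.symm.trans hτ))
      · simp
  simp only [mul_sub, Finset.sum_sub_distrib, hb, hz, Finset.sum_add_distrib]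
  rw [hsplit, inner_seqForm_eq_sum_initial, PiLp.inner_apply, Fintype.sum_sigma]
  simp

/-- Loss and prediction at `j` are formed with the same strategy below `j`, so the local prediction
error is the counterfactual of the global one. -/
theorem counterfactual_sub (v v' : EuclideanSpace ℝ (Σ j, A j)) (b : Behavior A) (j : J) :
    Q.counterfactual v b j - Q.counterfactual v' b j = Q.counterfactual (v - v') b j := by
  ext a
  simp [counterfactual, inner_sub_left]
  ring

theorem norm_counterfactual_le {B : J → ℝ}
    (hB : ∀ (h : J) (b : Behavior A), ‖Q.subSeqForm h b‖ ≤ B h)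
    (v : EuclideanSpace ℝ (Σ j, A j)) (b : Behavior A) (j : J) :
    ‖Q.counterfactual v b j‖ ≤ Fintype.card (A j) * (1 + ∑ j', B j') * ‖v‖ := by
  have hB0 : ∀ j, 0 ≤ B j := fun j => (norm_nonneg _).trans (hB j b)
  have hs : 0 ≤ ∑ j', B j' := Finset.sum_nonneg fun j _ => hB0 j
  rw [mul_assoc]
  refine norm_le_card_mul fun a => ?_
  change |v ⟨j, a⟩ + ∑ j' ∈ Q.children ⟨j, a⟩, inner ℝ v (Q.subSeqForm j' b)| ≤ _
  have h1 : |v ⟨j, a⟩| ≤ ‖v‖ := PiLp.norm_apply_le v ⟨j, a⟩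
  have h2 : |∑ j' ∈ Q.children ⟨j, a⟩, inner ℝ v (Q.subSeqForm j' b)| ≤ (∑ j', B j') * ‖v‖ := by
    refine (Finset.abs_sum_le_sum_abs _ _).trans ?_
    rw [Finset.sum_mul]
    refine (Finset.sum_le_sum fun j' _ => ?_).trans
      (Finset.sum_le_sum_of_subset_of_nonneg (Finset.subset_univ _) fun j' _ _ =>
        mul_nonneg (hB0 j') (norm_nonneg v))
    refine (abs_real_inner_le_norm _ _).trans ?_
    rw [mul_comm]
    exact mul_le_mul_of_nonneg_right (hB j' b) (norm_nonneg v)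
  linarith [abs_add_le (v ⟨j, a⟩) (∑ j' ∈ Q.children ⟨j, a⟩, inner ℝ v (Q.subSeqForm j' b))]

theorem exists_abs_seqForm_sub_le : ∃ K : ℝ, 0 ≤ K ∧ ∀ (b b' : Behavior A) (δ : ℝ),
    (∀ j a, |(b j).1 a - (b' j).1 a| ≤ δ) →
      ∀ σ, |Q.seqForm b σ - Q.seqForm b' σ| ≤ K * δ := by
  -- The total length of all sequences bounds the number of factors in each of them, uniformly in
  -- `σ`.
  refine ⟨∑ σ, (Q.seqTo σ).length, by positivity, fun b b' δ h σ => ?_⟩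
  have hδ : 0 ≤ δ := (abs_nonneg _).trans (h σ.1 σ.2)
  refine (Behavior.abs_weight_sub_le h (Q.seqTo σ)).trans (mul_le_mul_of_nonneg_right ?_ hδ)
  exact_mod_cast Finset.single_le_sum (f := fun σ => (Q.seqTo σ).length)
    (fun _ _ => Nat.zero_le _) (Finset.mem_univ σ)

/-- Linearity in `κ` is all that the rate needs from the recursion for `γ`; the remaining factor is
absorbed into the constant. -/
theorem localStability_eq (B : J → ℝ) (κ : ℝ) (j : J) :
    Q.localStability B κ j = κ * Q.localStability B 1 j := by
  simp only [localStability, gamma]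
  ring

end DecisionProcess

/-! ### Bilinear forms of matrices -/

open Matrix in
/-- The bilinear form of a matrix. -/
def matrixForm {S S' : Type*} [Fintype S] [Fintype S'] (P : Matrix S S' ℝ) (x : S → ℝ)
    (y : S' → ℝ) : ℝ := x ⬝ᵥ P *ᵥ y

theorem matrixForm_eq_sum {S S' : Type*} [Fintype S] [Fintype S'] (P : Matrix S S' ℝ) (x : S → ℝ)
    (y : S' → ℝ) : matrixForm P x y = ∑ s, ∑ s', x s * P s s' * y s' := by
  simp [matrixForm, dotProduct, Matrix.mulVec, Finset.mul_sum, mul_assoc]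

theorem matrixForm_sum {S S' : Type*} [Fintype S] [Fintype S'] {ι : Type*} (r : Finset ι)
    (P : ι → Matrix S S' ℝ) (x : S → ℝ) (y : S' → ℝ) :
    matrixForm (∑ k ∈ r, P k) x y = ∑ k ∈ r, matrixForm (P k) x y := by
  simp [matrixForm, Matrix.sum_mulVec, dotProduct_sum]

theorem matrixForm_smul {S S' : Type*} [Fintype S] [Fintype S'] (c : ℝ)
    (P : Matrix S S' ℝ) (x : S → ℝ) (y : S' → ℝ) :
    matrixForm (c • P) x y = c * matrixForm P x y := by
  simp [matrixForm, Matrix.smul_mulVec]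

/-! ### Payoffs and losses in terms of sequence forms -/

namespace ExtensiveGame

variable {I : Fin 2 → Type*} {A : ∀ i, I i → Type*} (G : ExtensiveGame I A)

theorem path_eq {i : Fin 2} {h : I i} {s : List (Σ h, A i h)}
    (hs : G.tree.Occurs i h s fun _ => []) : (G.process i).path h = s :=
  G.perfectRecall i h _ _ (G.occurs i h).choose_spec hs

variable [∀ i h, Fintype (A i h)]

/-- The payoff matrix records only last pairs. When the last pair determines the whole history, its
sequence-form entry is the weight of that history. -/
theorem withEmpty_seqForm_getLast? (i : Fin 2) (b : Behavior (A i)) {l : List (Σ h, A i h)}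
    (hl : ∀ s σ, l = s ++ [σ] → (G.process i).path σ.1 = s) :
    withEmpty ((G.process i).seqForm b) l.getLast? = b.weight l := by
  rcases List.eq_nil_or_concat l with rfl | ⟨s, σ, h⟩
  · rfl
  · rw [List.concat_eq_append] at h
    have := hl s σ h
    subst h
    simp only [List.getLast?_append, List.getLast?_singleton, Option.some_or]
    change (G.process i).seqForm b σ = _
    rw [DecisionProcess.seqForm_eq_weight, DecisionProcess.seqTo, this]

variable [∀ i, Fintype (I i)]

/-- Induction on the tree, with the weights of the entering histories carried along: a decision
multiplies the mover's weight by the probability of the action, and a leaf contributes a single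
matrix entry. The two hypotheses are the parts of perfect recall inherited by subtrees. -/
theorem matrixForm_payoffMatrix (b : ∀ i, Behavior (A i)) (t : GameTree I A) :
    ∀ q : History A,
      (∀ i h s, t.Occurs i h s q → (G.process i).path h = s) →
      (∀ i s σ, q i = s ++ [σ] → (G.process i).path σ.1 = s) →
      matrixForm (t.payoffMatrix q) (withEmpty ((G.process 0).seqForm (b 0)))
          (withEmpty ((G.process 1).seqForm (b 1))) =
        (b 0).weight (q 0) * (b 1).weight (q 1) * t.expectedPayoff b := by
  classical
  induction t with
  | leaf r =>
    intro q _ hq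
    rw [← G.withEmpty_seqForm_getLast? 0 (b 0) (hq 0), ← G.withEmpty_seqForm_getLast? 1 (b 1) (hq 1),
      matrixForm_eq_sum, Finset.sum_eq_single (q 0).getLast?, Finset.sum_eq_single (q 1).getLast?]
    · simp [GameTree.payoffMatrix, GameTree.expectedPayoff]
      ring
    · intro s' _ hs'
      simp [GameTree.payoffMatrix, hs'.symm]
    · simp
    · intro s _ hs
      simp [GameTree.payoffMatrix, hs.symm]
    · simp
  | chance n p next ih =>
    intro q ho hq
    rw [GameTree.payoffMatrix, matrixForm_sum, GameTree.expectedPayoff, Finset.mul_sum]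
    refine Finset.sum_congr rfl fun k _ => ?_
    rw [matrixForm_smul, ih k q (fun i h s hs => ho i h s ⟨k, hs⟩) hq]
    ring
  | decision i h next ih =>
    intro q ho hq
    rw [GameTree.payoffMatrix, matrixForm_sum, GameTree.expectedPayoff, Finset.mul_sum]
    refine Finset.sum_congr rfl fun a _ => ?_
    have hpath : (G.process i).path h = q i := ho i h (q i) (Or.inl ⟨rfl, rfl⟩)
    rw [ih a (q.extend i h a) (fun i' h' s hs => ho i' h' s (Or.inr ⟨a, hs⟩))]
    · have hw : (b 0).weight (q.extend i h a 0) * (b 1).weight (q.extend i h a 1) =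
          (b 0).weight (q 0) * (b 1).weight (q 1) * (b i h).1 a := by
        fin_cases i
        · simp [History.extend, Behavior.weight_concat]
          ring
        · simp [History.extend, Behavior.weight_concat]
          ring
      rw [hw]
      ring
    · intro i' s σ hs
      by_cases hi : i' = i
      · subst hi
        simp only [History.extend, Function.update_self] at hs
        obtain ⟨h1, h2⟩ := List.append_inj' hs rfl
        have h3 : σ = ⟨h, a⟩ := by simpa using h2.symm
        subst h3
        rw [← h1, ← hpath]
      · rw [History.extend, Function.update_of_ne hi] at hs
        exact hq i' s σ hs

/-- The bilinear payoff of a pair of sequence-form vectors. -/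
noncomputable def payoffForm (x : EuclideanSpace ℝ (Σ h, A 0 h))
    (y : EuclideanSpace ℝ (Σ h, A 1 h)) : ℝ :=
  matrixForm (G.tree.payoffMatrix fun _ => []) (withEmpty x) (withEmpty y)

/-- The expected payoff is bilinear in the sequence forms. -/
theorem expectedPayoff_eq (b : ∀ i, Behavior (A i)) :
    G.tree.expectedPayoff b =
      G.payoffForm ((G.process 0).seqForm (b 0)) ((G.process 1).seqForm (b 1)) := by
  rw [payoffForm, G.matrixForm_payoffMatrix b G.tree _ (fun i h s => G.path_eq) (by simp)]
  simp

/-- The missing empty-sequence entry has weight 1 for both `u` and `u'`, so it cancels in the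
difference. -/
theorem inner_loss_zero_sub (x : ∀ i, EuclideanSpace ℝ (Σ h, A i h))
    (u u' : EuclideanSpace ℝ (Σ h, A 0 h)) :
    inner ℝ (G.loss x 0) u - inner ℝ (G.loss x 0) u' =
      G.payoffForm u' (x 1) - G.payoffForm u (x 1) := by
  simp [payoffForm, matrixForm, loss, dotProduct, PiLp.inner_apply, withEmpty,
    Fintype.sum_option]
  ring

theorem inner_loss_one_sub (x : ∀ i, EuclideanSpace ℝ (Σ h, A i h))
    (u u' : EuclideanSpace ℝ (Σ h, A 1 h)) :
    inner ℝ (G.loss x 1) u - inner ℝ (G.loss x 1) u' =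
      G.payoffForm (x 0) u - G.payoffForm (x 0) u' := by
  simp only [payoffForm, matrixForm, loss, Matrix.dotProduct_mulVec, ← Matrix.mulVec_transpose]
  simp [dotProduct, PiLp.inner_apply, withEmpty, Fintype.sum_option, mul_comm]

theorem withEmpty_average {S : Type*} {T : ℕ} (hT : 1 ≤ T) (x : ℕ → EuclideanSpace ℝ S) :
    withEmpty ((1 / (T : ℝ)) • ∑ t ∈ Finset.range T, x t) =
      (1 / (T : ℝ)) • ∑ t ∈ Finset.range T, withEmpty (x t) := by
  have hT' : (T : ℝ) ≠ 0 := by positivity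
  funext o
  rcases o with _ | σ
  · simp [withEmpty, hT']
  · simp [withEmpty]

theorem payoffForm_average_right {T : ℕ} (hT : 1 ≤ T) (x : EuclideanSpace ℝ (Σ h, A 0 h))
    (y : ℕ → EuclideanSpace ℝ (Σ h, A 1 h)) :
    G.payoffForm x ((1 / (T : ℝ)) • ∑ t ∈ Finset.range T, y t) =
      (1 / (T : ℝ)) * ∑ t ∈ Finset.range T, G.payoffForm x (y t) := by
  rw [payoffForm, withEmpty_average hT]
  simp [payoffForm, matrixForm, Matrix.mulVec_smul, Matrix.mulVec_sum,
    dotProduct_sum]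

theorem payoffForm_average_left {T : ℕ} (hT : 1 ≤ T) (x : ℕ → EuclideanSpace ℝ (Σ h, A 0 h))
    (y : EuclideanSpace ℝ (Σ h, A 1 h)) :
    G.payoffForm ((1 / (T : ℝ)) • ∑ t ∈ Finset.range T, x t) y =
      (1 / (T : ℝ)) * ∑ t ∈ Finset.range T, G.payoffForm (x t) y := by
  rw [payoffForm, withEmpty_average hT]
  simp [payoffForm, matrixForm, sum_dotProduct]

theorem exists_norm_loss_sub_le : ∃ K : ℝ, 0 ≤ K ∧
    ∀ (x x' : ∀ i, EuclideanSpace ℝ (Σ h, A i h)) (δ : ℝ), 0 ≤ δ →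
      (∀ i σ, |x i σ - x' i σ| ≤ δ) → ∀ i, ‖G.loss x i - G.loss x' i‖ ≤ K * δ := by
  set P := G.tree.payoffMatrix fun _ => [] with hP
  set S : ℝ := ∑ s, ∑ s', |P s s'| with hS
  have hS0 : 0 ≤ S := Finset.sum_nonneg fun _ _ => Finset.sum_nonneg fun _ _ => abs_nonneg _
  refine ⟨(Fintype.card (Σ h, A 0 h) + Fintype.card (Σ h, A 1 h)) * S, by positivity,
    fun x x' δ hδ hx => ?_⟩
  have hw : ∀ i o, |withEmpty (x i) o - withEmpty (x' i) o| ≤ δ := by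
    rintro i (_ | σ)
    · simpa [withEmpty] using hδ
    · exact hx i σ
  have h0 : ∀ σ, |(G.loss x 0 - G.loss x' 0) σ| ≤ S * δ := by
    intro σ
    have e : (G.loss x 0 - G.loss x' 0) σ =
        -∑ s', P (some σ) s' * (withEmpty (x 1) s' - withEmpty (x' 1) s') := by
      simp only [mul_sub, Finset.sum_sub_distrib]
      simp [loss, Matrix.mulVec, dotProduct, hP]
      ring
    rw [e, abs_neg]
    refine (Finset.abs_sum_le_sum_abs _ _).trans ?_
    calc _ ≤ ∑ s', |P (some σ) s'| * δ := Finset.sum_le_sum fun s' _ => by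
          rw [abs_mul]; exact mul_le_mul_of_nonneg_left (hw 1 s') (abs_nonneg _)
      _ = (∑ s', |P (some σ) s'|) * δ := by rw [Finset.sum_mul]
      _ ≤ S * δ := mul_le_mul_of_nonneg_right (Finset.single_le_sum
          (f := fun s => ∑ s', |P s s'|) (fun _ _ => Finset.sum_nonneg fun _ _ => abs_nonneg _)
          (Finset.mem_univ (some σ))) hδ
  have h1 : ∀ σ, |(G.loss x 1 - G.loss x' 1) σ| ≤ S * δ := by
    intro σ
    have e : (G.loss x 1 - G.loss x' 1) σ =
        ∑ s, P s (some σ) * (withEmpty (x 0) s - withEmpty (x' 0) s) := by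
      simp only [mul_sub, Finset.sum_sub_distrib]
      simp [loss, Matrix.mulVec, dotProduct, hP]
    rw [e]
    refine (Finset.abs_sum_le_sum_abs _ _).trans ?_
    calc _ ≤ ∑ s, |P s (some σ)| * δ := Finset.sum_le_sum fun s' _ => by
          rw [abs_mul]; exact mul_le_mul_of_nonneg_left (hw 0 s') (abs_nonneg _)
      _ = (∑ s, |P s (some σ)|) * δ := by rw [Finset.sum_mul]
      _ ≤ S * δ := mul_le_mul_of_nonneg_right (Finset.sum_le_sum fun s _ =>
          Finset.single_le_sum (f := fun s' => |P s s'|) (fun _ _ => abs_nonneg _)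
          (Finset.mem_univ (some σ))) hδ
  have hSδ : 0 ≤ S * δ := mul_nonneg hS0 hδ
  intro i
  match i with
  | 0 =>
    refine (norm_le_card_mul h0).trans ?_
    rw [mul_assoc]
    exact mul_le_mul_of_nonneg_right (le_add_of_nonneg_right (Nat.cast_nonneg _)) hSδ
  | 1 =>
    refine (norm_le_card_mul h1).trans ?_
    rw [mul_assoc]
    exact mul_le_mul_of_nonneg_right (le_add_of_nonneg_left (Nat.cast_nonneg _)) hSδ

end ExtensiveGame

/-! ### Regret in self-play and approximate equilibrium -/

namespace ExtensiveGame

variable {I : Fin 2 → Type*} {A : ∀ i, I i → Type*} (G : ExtensiveGame I A)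
  [∀ i h, Fintype (A i h)] [∀ i, Fintype (I i)]

/-- The losses of both players vary at most proportionally to the change of the behavioral
strategies. -/
theorem exists_norm_loss_seqForm_sub_le : ∃ K : ℝ, 0 ≤ K ∧
    ∀ (b b' : ∀ i, Behavior (A i)) (δ : ℝ), 0 ≤ δ →
      (∀ i h a, |(b i h).1 a - (b' i h).1 a| ≤ δ) → ∀ i,
        ‖G.loss (fun i => (G.process i).seqForm (b i)) i -
          G.loss (fun i => (G.process i).seqForm (b' i)) i‖ ≤ K * δ := by
  choose K hK0 hK using fun i => (G.process i).exists_abs_seqForm_sub_le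
  obtain ⟨L, hL0, hL⟩ := G.exists_norm_loss_sub_le
  have hs : 0 ≤ ∑ i, K i := Finset.sum_nonneg fun i _ => hK0 i
  refine ⟨L * ∑ i, K i, mul_nonneg hL0 hs, fun b b' δ hδ h i => ?_⟩
  rw [mul_assoc]
  refine hL _ _ _ (mul_nonneg hs hδ) (fun i σ => (hK i _ _ δ (h i) σ).trans ?_) i
  exact mul_le_mul_of_nonneg_right
    (Finset.single_le_sum (f := K) (fun i _ => hK0 i) (Finset.mem_univ i)) hδ

/-- The losses of both players are bounded on sequence forms. -/
theorem exists_norm_loss_seqForm_le : ∃ K : ℝ, ∀ (b : ∀ i, Behavior (A i)) (i : Fin 2),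
    ‖G.loss (fun i => (G.process i).seqForm (b i)) i‖ ≤ K := by
  obtain ⟨L, hL0, hL⟩ := G.exists_norm_loss_sub_le
  -- Comparison with the zero vectors, from which sequence forms differ by at most 1 in each entry.
  refine ⟨L * 1 + ∑ i, ‖G.loss (fun _ => 0) i‖, fun b i => ?_⟩
  have h1 := hL (fun i => (G.process i).seqForm (b i)) (fun _ => 0) 1 zero_le_one
    (fun i σ => by simpa using (G.process i).abs_seqForm_le_one (b i) σ) i
  have h2 : ‖G.loss (fun _ => 0) i‖ ≤ ∑ i, ‖G.loss (fun _ => 0) i‖ :=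
    Finset.single_le_sum (f := fun i => ‖G.loss (fun _ => 0) i‖)
      (fun i _ => norm_nonneg _) (Finset.mem_univ i)
  have h3 := norm_le_norm_sub_add (G.loss (fun i => (G.process i).seqForm (b i)) i)
    (G.loss (fun _ => 0) i)
  linarith

/-- The regret of a player is at most the sum over his decision points of upper bounds for the
local regrets. -/
theorem regret_le_sum_local {R : ∀ i (h : I i), PredictiveRegretMinimizer _ (simplex (A i h))}
    {m₀ : ∀ i, EuclideanSpace ℝ (Σ h, A i h)} {b : ℕ → ∀ i, Behavior (A i)}
    (hb : G.IsSelfPlay R m₀ b) (i : Fin 2) (T : ℕ) (U : I i → ℝ) (hU0 : ∀ h, 0 ≤ U h)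
    (hU : ∀ h, ∀ z ∈ simplex (A i h), regretAgainst (G.localLoss b i h)
      ((R i h).decisionAt (G.localLoss b i h) (G.localPrediction m₀ b i h)) T z ≤ U h)
    (z : Behavior (A i)) :
    regretAgainst (G.roundLoss b i) (fun t => (G.process i).seqForm (b t i)) T
      ((G.process i).seqForm z) ≤ ∑ h, U h := by
  have e : regretAgainst (G.roundLoss b i) (fun t => (G.process i).seqForm (b t i)) T
      ((G.process i).seqForm z) = ∑ h, z.weight ((G.process i).path h) *
        regretAgainst (G.localLoss b i h)
          ((R i h).decisionAt (G.localLoss b i h) (G.localPrediction m₀ b i h)) T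
          (WithLp.toLp 2 (z h).1) := by
    simp only [regretAgainst, ← Finset.sum_sub_distrib,
      DecisionProcess.inner_seqForm_sub_inner_seqForm, Finset.mul_sum]
    rw [Finset.sum_comm]
    refine Finset.sum_congr rfl fun h _ => Finset.sum_congr rfl fun t _ => ?_
    rw [← hb t i h]
    rfl
  rw [e]
  refine Finset.sum_le_sum fun h _ => ?_
  -- The reach weight, being at most 1, can be dropped because `U h` is nonnegative.
  calc _ ≤ z.weight ((G.process i).path h) * U h :=
        mul_le_mul_of_nonneg_left (hU h _ (z h).2) (z.weight_nonneg _)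
    _ ≤ U h := mul_le_of_le_one_left (hU0 h) (z.weight_le_one _)

/-- With stability parameters of order `τ = T ^ (-1/4)`, the regret of each player in self-play is
of order `τ⁻¹ = T ^ (1/4)`. -/
theorem exists_regret_le (B : ∀ i, I i → ℝ)
    (hB : ∀ i (h : I i) (b : Behavior (A i)), ‖(G.process i).subSeqForm h b‖ ≤ B i h)
    (α β c₁ c₂ M : ℝ) (hc₁ : 0 < c₁) :
    ∃ K : ℝ, ∀ (T : ℕ) (τ : ℝ), 1 ≤ T → 0 < τ → T * τ ^ 4 = 1 →
      ∀ κ : Fin 2 → ℝ, (∀ i, c₁ * τ ≤ κ i ∧ κ i ≤ c₂ * τ) →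
      ∀ (R : ∀ i (h : I i), PredictiveRegretMinimizer _ (simplex (A i h)))
        (m₀ : ∀ i, EuclideanSpace ℝ (Σ h, A i h)), (∀ i, ‖m₀ i‖ ≤ M) →
      ∀ b : ℕ → ∀ i, Behavior (A i), G.IsSelfPlay R m₀ b →
        (∀ i h, (R i h).IsStablePredictiveOn ((G.process i).localStability (B i) (κ i) h) α β
          (G.localLoss b i h) (G.localPrediction m₀ b i h)) →
        ∀ i (z : Behavior (A i)),
          regretAgainst (G.roundLoss b i) (fun t => (G.process i).seqForm (b t i)) T
            ((G.process i).seqForm z) ≤ K * τ⁻¹ := by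
  obtain ⟨KL, hKL0, hKL⟩ := G.exists_norm_loss_seqForm_sub_le
  obtain ⟨KB, hKB⟩ := G.exists_norm_loss_seqForm_le
  set k : ∀ i, I i → ℝ := fun i h => (G.process i).localStability (B i) 1 h with hk
  set D : ℝ := |c₂| * ∑ i, ∑ h, |k i h| with hD
  have hD0 : 0 ≤ D := mul_nonneg (abs_nonneg _)
    (Finset.sum_nonneg fun _ _ => Finset.sum_nonneg fun _ _ => abs_nonneg _)
  set E : ℝ := KL * D with hE
  set F : ℝ := KB + M with hF
  set N : ∀ i, I i → ℝ := fun i h => Fintype.card (A i h) * (1 + ∑ h', B i h') with hN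
  -- The summands bound the `α` and `β` terms, divided by `τ⁻¹`. Absolute values are needed as `α`,
  -- `β` and `c₂` carry no sign assumption.
  set L : ∀ i, I i → ℝ := fun i h =>
    |α / k i h| / c₁ + |β * k i h| * |c₂| * (N i h ^ 2 * (F ^ 2 + E ^ 2)) with hL
  have hL0 : ∀ i h, 0 ≤ L i h := fun i h => by positivity
  refine ⟨∑ i, ∑ h, L i h, fun T τ hT hτ hTτ κ hκ R m₀ hm₀ b hb hst i z => ?_⟩
  have hT1 : (1 : ℝ) ≤ T := by exact_mod_cast hT
  have hτ1 : τ ≤ 1 := by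
    rw [← pow_le_one_iff_of_nonneg hτ.le (n := 4) (by norm_num)]
    nlinarith [pow_pos hτ 4]
  have hκ0 : ∀ i, 0 < κ i := fun i => lt_of_lt_of_le (mul_pos hc₁ hτ) (hκ i).1
  have hκ2 : ∀ i, κ i ≤ |c₂| * τ := fun i =>
    (hκ i).2.trans (mul_le_mul_of_nonneg_right (le_abs_self c₂) hτ.le)
  have hmove : ∀ t i h a, |(b (t + 1) i h).1 a - (b t i h).1 a| ≤ D * τ := by
    intro t i h a
    have h1 := (hst i h).1 t
    rw [← hb t i h, ← hb (t + 1) i h, DecisionProcess.localStability_eq] at h1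
    have h2 : |(b (t + 1) i h).1 a - (b t i h).1 a| ≤ κ i * k i h :=
      (PiLp.norm_apply_le (WithLp.toLp 2 (b (t + 1) i h).1 - WithLp.toLp 2 (b t i h).1) a).trans h1
    have h3 : |k i h| ≤ ∑ i, ∑ h, |k i h| :=
      (Finset.single_le_sum (f := fun h => |k i h|) (fun _ _ => abs_nonneg _)
        (Finset.mem_univ h)).trans
      (Finset.single_le_sum (f := fun i => ∑ h, |k i h|)
        (fun _ _ => Finset.sum_nonneg fun _ _ => abs_nonneg _) (Finset.mem_univ i))
    calc _ ≤ κ i * k i h := h2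
      _ ≤ κ i * |k i h| := mul_le_mul_of_nonneg_left (le_abs_self _) (hκ0 i).le
      _ ≤ (|c₂| * τ) * ∑ i, ∑ h, |k i h| :=
        mul_le_mul (hκ2 i) h3 (abs_nonneg _) (by positivity)
      _ = D * τ := by rw [hD]; ring
  -- From the second round on, the prediction error is the change of the loss over one round;
  -- `hzero` treats the first round, where the prediction is only bounded.
  have hstep : ∀ t, ‖G.roundLoss b i (t + 1) - G.roundPrediction m₀ b i (t + 1)‖ ≤ E * τ := by
    intro t
    have := hKL (b (t + 1)) (b t) (D * τ) (by positivity) (hmove t) i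
    rw [hE, mul_assoc]
    exact this
  have hzero : ‖G.roundLoss b i 0 - G.roundPrediction m₀ b i 0‖ ≤ F :=
    (norm_sub_le _ _).trans (add_le_add (hKB (b 0) i) (hm₀ i))
  have hsum : ∑ t ∈ Finset.range T, ‖G.roundLoss b i t - G.roundPrediction m₀ b i t‖ ^ 2 ≤
      F ^ 2 + T * (E * τ) ^ 2 := by
    obtain ⟨n, rfl⟩ : ∃ n, T = n + 1 := ⟨T - 1, by omega⟩
    rw [Finset.sum_range_succ']
    have h1 : ∑ t ∈ Finset.range n,
        ‖G.roundLoss b i (t + 1) - G.roundPrediction m₀ b i (t + 1)‖ ^ 2 ≤ n * (E * τ) ^ 2 := by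
      refine (Finset.sum_le_sum fun t _ => pow_le_pow_left₀ (norm_nonneg _) (hstep t) 2).trans ?_
      simp
    have h2 := pow_le_pow_left₀ (norm_nonneg _) hzero 2
    push_cast
    nlinarith [sq_nonneg (E * τ)]
  have hlocal : ∀ h, ∑ t ∈ Finset.range T, ‖G.localLoss b i h t - G.localPrediction m₀ b i h t‖ ^ 2
      ≤ N i h ^ 2 * (F ^ 2 + T * (E * τ) ^ 2) := by
    intro h
    refine le_trans ?_ (mul_le_mul_of_nonneg_left hsum (sq_nonneg _))
    rw [Finset.mul_sum]
    refine Finset.sum_le_sum fun t _ => ?_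
    rw [← mul_pow]
    refine pow_le_pow_left₀ (norm_nonneg _) ?_ 2
    rw [localLoss, localPrediction, DecisionProcess.counterfactual_sub]
    exact (G.process i).norm_counterfactual_le (hB i) _ _ h
  -- These absorb the two parts of `κ` times the squared errors: the first round gives order `τ`,
  -- the later ones order `T * τ ^ 3`.
  have hτinv : τ ≤ τ⁻¹ := hτ1.trans ((one_le_inv₀ hτ).2 hτ1)
  have hcube : (T : ℝ) * τ ^ 3 = τ⁻¹ := by
    field_simp
    linarith
  have hregret : ∀ h, ∀ z ∈ simplex (A i h), regretAgainst (G.localLoss b i h)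
      ((R i h).decisionAt (G.localLoss b i h) (G.localPrediction m₀ b i h)) T z ≤
        L i h * τ⁻¹ := by
    intro h z hz
    refine ((hst i h).2 T z hz).trans ?_
    rw [DecisionProcess.localStability_eq]
    set S := ∑ t ∈ Finset.range T, ‖G.localLoss b i h t - G.localPrediction m₀ b i h t‖ ^ 2 with hS
    have hS0 : 0 ≤ S := Finset.sum_nonneg fun _ _ => sq_nonneg _
    have h1 : α / (κ i * k i h) ≤ |α / k i h| / c₁ * τ⁻¹ := by
      calc α / (κ i * k i h) = (α / k i h) / κ i := by rw [div_div, mul_comm]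
        _ ≤ |α / k i h| / κ i := div_le_div_of_nonneg_right (le_abs_self _) (hκ0 i).le
        _ ≤ |α / k i h| / (c₁ * τ) :=
          div_le_div_of_nonneg_left (abs_nonneg _) (mul_pos hc₁ hτ) (hκ i).1
        _ = |α / k i h| / c₁ * τ⁻¹ := by rw [← div_div, div_eq_mul_inv _ τ]
    have h2 : β * (κ i * k i h) * S ≤
        |β * k i h| * |c₂| * (N i h ^ 2 * (F ^ 2 + E ^ 2)) * τ⁻¹ := by
      calc β * (κ i * k i h) * S = (β * k i h) * κ i * S := by ring
        _ ≤ |β * k i h| * (|c₂| * τ) * (N i h ^ 2 * (F ^ 2 + T * (E * τ) ^ 2)) := by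
          refine mul_le_mul ?_ (hlocal h) hS0 (by positivity)
          exact mul_le_mul (le_abs_self _) (hκ2 i) (hκ0 i).le (abs_nonneg _)
        _ = |β * k i h| * |c₂| * (N i h ^ 2 * (F ^ 2 * τ + E ^ 2 * (T * τ ^ 3))) := by ring
        _ ≤ |β * k i h| * |c₂| * (N i h ^ 2 * (F ^ 2 * τ⁻¹ + E ^ 2 * τ⁻¹)) := by
          rw [hcube]
          gcongr
        _ = _ := by ring
    calc _ ≤ _ := add_le_add h1 h2
      _ = L i h * τ⁻¹ := by rw [hL]; ring
  refine (G.regret_le_sum_local hb i T (fun h => L i h * τ⁻¹)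
    (fun h => mul_nonneg (hL0 i h) (inv_nonneg.2 hτ.le)) hregret z).trans ?_
  rw [← Finset.sum_mul]
  exact mul_le_mul_of_nonneg_right (Finset.single_le_sum (f := fun i => ∑ h, L i h)
    (fun i _ => Finset.sum_nonneg fun h _ => hL0 i h) (Finset.mem_univ i)) (inv_nonneg.2 hτ.le)

/-- If both players have regret at most `r` after `T` rounds, then the profiles whose sequence
forms are the averages are `2 r / T`-Nash equilibria. -/
theorem isNash_of_regret_le {T : ℕ} (hT : 1 ≤ T) {r : ℝ} (b : ℕ → ∀ i, Behavior (A i))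
    (hr : ∀ i (z : Behavior (A i)),
      regretAgainst (G.roundLoss b i) (fun t => (G.process i).seqForm (b t i)) T
        ((G.process i).seqForm z) ≤ r)
    (σ : ∀ i, Behavior (A i)) (hσ : ∀ i, (G.process i).seqForm (σ i) =
      (1 / (T : ℝ)) • ∑ t ∈ Finset.range T, (G.process i).seqForm (b t i)) :
    G.IsNash (2 * r / T) σ := by
  have hT0 : (0 : ℝ) < T := by exact_mod_cast hT
  -- The saddle-point gap at the averages; `w = σ 1` and `u = σ 0` recover the deviations of the
  -- single players.
  have key : ∀ (u : Behavior (A 0)) (w : Behavior (A 1)),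
      G.payoffForm ((G.process 0).seqForm u) ((G.process 1).seqForm (σ 1)) -
        G.payoffForm ((G.process 0).seqForm (σ 0)) ((G.process 1).seqForm w) ≤ 2 * r / T := by
    intro u w
    have h0 := hr 0 u
    have h1 := hr 1 w
    simp only [regretAgainst, ← Finset.sum_sub_distrib, roundLoss, inner_loss_zero_sub,
      inner_loss_one_sub] at h0 h1
    rw [hσ 0, hσ 1, G.payoffForm_average_right hT, G.payoffForm_average_left hT, ← mul_sub,
      one_div_mul_eq_div]
    refine div_le_div_of_nonneg_right ?_ hT0.le
    rw [Finset.sum_sub_distrib] at h0 h1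
    linarith
  intro i b'
  match i with
  | 0 =>
    have := key b' (σ 1)
    simp only [utility, if_true, expectedPayoff_eq, Function.update_self]
    rw [Function.update_of_ne (by decide)]
    linarith
  | 1 =>
    have := key (σ 0) b'
    simp only [utility, one_ne_zero, if_false, expectedPayoff_eq, Function.update_self]
    rw [Function.update_of_ne (by decide)]
    linarith

end ExtensiveGame
end StablePredictiveCFR

theorem mainTheorem4 {I : Fin 2 → Type*} {A : ∀ i, I i → Type*} [∀ i, Fintype (I i)]
    [∀ i h, Fintype (A i h)] [∀ i h, Nonempty (A i h)]
    (G : StablePredictiveCFR.ExtensiveGame I A)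
    (B : ∀ i, I i → ℝ)
    (hB : ∀ i (h : I i) (b : StablePredictiveCFR.Behavior (A i)),
      ‖(G.process i).subSeqForm h b‖ ≤ B i h)
    (α β c₁ c₂ M : ℝ) (hc₁ : 0 < c₁) :
    ∃ C : ℝ, ∀ T : ℕ, 1 ≤ T →
      ∀ κ : Fin 2 → ℝ,
        (∀ i, c₁ * (T : ℝ) ^ (-(1 / 4) : ℝ) ≤ κ i ∧ κ i ≤ c₂ * (T : ℝ) ^ (-(1 / 4) : ℝ)) →
      ∀ (R : ∀ i (h : I i), StablePredictiveCFR.PredictiveRegretMinimizer _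
            (StablePredictiveCFR.simplex (A i h)))
        (m₀ : ∀ i, EuclideanSpace ℝ (Σ h, A i h)), (∀ i, ‖m₀ i‖ ≤ M) →
      ∀ b : ℕ → ∀ i, StablePredictiveCFR.Behavior (A i),
        G.IsSelfPlay R m₀ b →
        (∀ i h, (R i h).IsStablePredictiveOn ((G.process i).localStability (B i) (κ i) h) α β
          (G.localLoss b i h) (G.localPrediction m₀ b i h)) →
        (∃ σ : ∀ i, StablePredictiveCFR.Behavior (A i), ∀ i, (G.process i).seqForm (σ i) =
          (1 / (T : ℝ)) • ∑ t ∈ Finset.range T, (G.process i).seqForm (b t i)) ∧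
        ∀ σ : ∀ i, StablePredictiveCFR.Behavior (A i),
          (∀ i, (G.process i).seqForm (σ i) =
            (1 / (T : ℝ)) • ∑ t ∈ Finset.range T, (G.process i).seqForm (b t i)) →
          G.IsNash (C * (T : ℝ) ^ (-(3 / 4) : ℝ)) σ := by
  obtain ⟨K, hK⟩ := G.exists_regret_le B hB α β c₁ c₂ M hc₁
  refine ⟨2 * K, fun T hT κ hκ R m₀ hm₀ b hb hst => ?_⟩
  have hT0 : (0 : ℝ) < T := by exact_mod_cast hT
  set τ : ℝ := (T : ℝ) ^ (-(1 / 4) : ℝ) with hτ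
  have hτ0 : 0 < τ := Real.rpow_pos_of_pos hT0 _
  have hτ4 : T * τ ^ 4 = 1 := by
    rw [hτ, ← Real.rpow_natCast, ← Real.rpow_mul hT0.le]
    norm_num [Real.rpow_neg_one, hT0.ne']
  have hτ3 : (T : ℝ) ^ (-(3 / 4) : ℝ) = τ ^ 3 := by
    rw [hτ, ← Real.rpow_natCast, ← Real.rpow_mul hT0.le]
    norm_num
  refine ⟨?_, fun σ hσ => ?_⟩
  · choose σ hσ using fun i => (G.process i).exists_seqForm_eq_average hT fun t => b t i
    exact ⟨σ, hσ⟩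
  · have := G.isNash_of_regret_le hT b (hK T τ hT hτ0 hτ4 κ hκ R m₀ hm₀ b hb hst) σ hσ
    -- Since `T * τ ^ 4 = 1`, dividing by `T` amounts to multiplying by `τ ^ 4`.
    have e : 2 * (K * τ⁻¹) / T = 2 * K * τ ^ 3 := by
      field_simp
      linear_combination (-K) * hτ4
    rw [hτ3, ← e]
    exact this
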